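/- Let $\mathscr{M}$ be the set of isometry classes of non-empty compact metric spaces, equipped with the Gromov–Hausdorff distance $\mathcal{GH}$, and let $\mathbf{Q}=[0,1]^{\mathbb{N}}$ be the Hilbert cube with the product topology. A map $\mathcal{D}:\mathscr{M}\to[0,\infty]$ is called a *dimensional function* if (i) $\mathcal{D}(S,d)\le\mathcal{D}(X,d)$ for every $(X,d)\in\mathscr{M}$ and every non-empty closed subset $S\subset X$ (with the restricted metric), and (ii) for every $\epsilon\in(0,\infty)$ there is a non-empty compact metric space $(Z,h)$ with $\mathcal{D}(Z,h)=\infty$ and diameter at most $\epsilon$. Put $\mathscr{I}(\mathcal{D})=\{(X,d)\in\mathscr{M} : \mathcal{D}(X,d)=\infty\}$. A *geodesic* from $x$ to $y$ in $\mathscr{M}$ is a continuous map $\gamma:[0,1]\to\mathscr{M}$ with $\gamma(0)=x$, $\gamma(1)=y$ and $\mathcal{GH}(\gamma(s),\gamma(t))=|s-t|\cdot\mathcal{GH}(x,y)$ for all $s,t\in[0,1]$. For a closed set $A\subset[0,1]$ with $\{0,1\}\subset A$, an *$A$-branching bunch of geodesics* from $x$ to $y$ is a continuous map $F:[0,1]\times\mathbf{Q}\to\mathscr{M}$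 such that 1. $F(0,q)=x$ and $F(1,q)=y$ for every $q\in\mathbf{Q}$; 2. $F(s,q)=F(s,r)$ for every $s\in A$ and all $q,r\in\mathbf{Q}$; 3. for each $q\in\mathbf{Q}$ the map $s\mapsto F(s,q)$ is a geodesic from $x$ to $y$; 4. $F(s,q)\ne F(t,r)$ for all $(s,q),(t,r)\in([0,1]\setminus A)\times\mathbf{Q}$ with $(s,q)\neq(t,r)$. **Theorem.** Let $\mathcal{D}$ be a dimensional function, let $(X,d),(Y,e)\in\mathscr{I}(\mathcal{D})$ satisfy $\mathcal{GH}((X,d),(Y,e))>0$, and let $A$ be a closed subset of $[0,1]$ with $\{0,1\}\subset A$. Then there exists an $A$-branching bunch of geodesics $F:[0,1]\times\mathbf{Q}\to\mathscr{M}$ from $(X,d)$ to $(Y,e)$ such that $F(s,q)\in\mathscr{I}(\mathcal{D})$ for all $(s,q)\in[0,1]\times\mathbf{Q}$. -/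

import Mathlib

open GromovHausdorff
open scoped unitInterval ENNReal

/-- A geodesic from `x` to `y` in a metric space `M`: a continuous map `γ : [0, 1] → M` with
`γ 0 = x`, `γ 1 = y` and `d (γ s) (γ t) = |s - t| * d x y` for all `s, t`. -/
structure IsGeodesic {M : Type*} [MetricSpace M] (x y : M) (γ : I → M) : Prop where
  continuous : Continuous γ
  source : γ 0 = x
  target : γ 1 = y
  dist_eq : ∀ s t : I, dist (γ s) (γ t) = |(s : ℝ) - (t : ℝ)| * dist x y

/-- The Hilbert cube `[0, 1]^ℕ` with the product topology. -/
abbrev HilbertCube : Type := ℕ → I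

/-- An `A`-branching bunch of geodesics from `x` to `y` in a metric space `M`
(to be used with `M` the Gromov--Hausdorff space and `A` closed, `0, 1 ∈ A`). -/
structure IsBranchingBunch {M : Type*} [MetricSpace M] (A : Set I) (x y : M)
    (F : I × HilbertCube → M) : Prop where
  continuous : Continuous F
  endpoints : ∀ q : HilbertCube, F (0, q) = x ∧ F (1, q) = y
  eq_on : ∀ s ∈ A, ∀ q r : HilbertCube, F (s, q) = F (s, r)
  geodesic : ∀ q : HilbertCube, IsGeodesic x y (fun s => F (s, q))
  ne_off : ∀ (s t : I) (q r : HilbertCube), s ∉ A → t ∉ A → (s, q) ≠ (t, r) →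
    F (s, q) ≠ F (t, r)

/-- A dimensional function: a `[0, ∞]`-valued function on the set `GHSpace` of isometry classes of
nonempty compact metric spaces which is monotone under passing to (nonempty) closed subsets with
the restricted metric, and for which there are compact metric spaces of arbitrarily small diameter
with value `∞`. -/
structure IsDimensionalFunction (D : GHSpace → ℝ≥0∞) : Prop where
  mono : ∀ (X : Type) [MetricSpace X] [CompactSpace X] [Nonempty X] (S : Set X)
    (hS : IsClosed S) (hne : S.Nonempty),
    D (TopologicalSpace.NonemptyCompacts.toGHSpace ⟨⟨S, hS.isCompact⟩, hne⟩) ≤ D (toGHSpace X)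
  small : ∀ ε : ℝ, 0 < ε →
    ∃ (Y : Type) (_ : MetricSpace Y) (_ : CompactSpace Y) (_ : Nonempty Y),
      D (toGHSpace Y) = ⊤ ∧ Metric.diam (Set.univ : Set Y) ≤ ε

/-- The set of all (isometry classes of) compact metric spaces at which `D` is infinite. -/
def infiniteSet (D : GHSpace → ℝ≥0∞) : Set GHSpace := {x | D x = ⊤}

/-!
Interpolating linearly between `d_X` and `d_Y` along a correspondence `K` of least distortion gives
a geodesic. There is slack: a maximum of pseudo-metrics whose values change at speed at most
`2 * dist x y` still has quotients moving at speed at most `dist x y`, and a path from `x` to `y` at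
that speed is a geodesic. Two further pseudo-metrics vanishing at both endpoints are therefore added
for free. A truncated copy of a compact perfect space `Z` containing arbitrarily small spaces of
infinite dimension makes the intermediate spaces infinite-dimensional and the points of `K × Z`
non-isolated. A comb, i.e. a sequence of isolated points converging to a point of `K × Z`, has
heights proportional to the distance of the time from `A`; since the isolated points and their
distances to the rest are isometry invariants, so is the point of the Hilbert cube encoded in the
heights. Members of the bunch at different times differ because both lie on geodesics from `x`.
-/

open scoped NNReal Topology

section GromovHausdorff

variable {X Y : Type*} [MetricSpace X] [CompactSpace X] [Nonempty X]
  [MetricSpace Y] [CompactSpace Y] [Nonempty Y]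

theorem ghDist_le_of_surjective {W : Type*} {f : W → X} {g : W → Y}
    (hf : Function.Surjective f) (hg : Function.Surjective g) {δ : ℝ}
    (hfg : ∀ v w, |dist (f v) (f w) - dist (g v) (g w)| ≤ 2 * δ) : ghDist X Y ≤ δ := by
  have : Nonempty W := hf.nonempty
  refine le_of_forall_pos_le_add fun ε hε => ?_
  have hpos : 0 < δ + ε := by
    have w := Classical.arbitrary W
    linarith [(abs_nonneg _).trans (hfg w w)]
  let _ : MetricSpace (X ⊕ Y) := Metric.glueMetricApprox f g (δ + ε) hpos
    fun v w => (hfg v w).trans (by linarith)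
  have dist_glued : ∀ w, dist (Sum.inl (f w) : X ⊕ Y) (Sum.inr (g w)) = δ + ε :=
    Metric.glueDist_glued_points f g (δ + ε)
  refine (ghDist_le_hausdorffDist (Φ := (Sum.inl : X → X ⊕ Y)) (Ψ := (Sum.inr : Y → X ⊕ Y))
    (.of_dist_eq fun _ _ => rfl) (.of_dist_eq fun _ _ => rfl)).trans
    (Metric.hausdorffDist_le_of_mem_dist hpos.le ?_ ?_)
  · rintro _ ⟨x, rfl⟩
    obtain ⟨w, rfl⟩ := hf x
    exact ⟨_, ⟨g w, rfl⟩, (dist_glued w).le⟩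
  · rintro _ ⟨y, rfl⟩
    obtain ⟨w, rfl⟩ := hg y
    exact ⟨_, ⟨f w, rfl⟩, (dist_comm _ _).trans_le (dist_glued w).le⟩

theorem exists_dist_le_hausdorffDist {M : Type*} [PseudoMetricSpace M] {s t : Set M} {x : M}
    (hs : Bornology.IsBounded s) (ht : IsCompact t) (hne : t.Nonempty) (hx : x ∈ s) :
    ∃ y ∈ t, dist x y ≤ Metric.hausdorffDist s t := by
  obtain ⟨y, hy, hxy⟩ := ht.exists_infDist_eq_dist hne x
  exact ⟨y, hy, hxy ▸ Metric.infDist_le_hausdorffDist_of_mem hx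
    (Metric.hausdorffEDist_ne_top_of_nonempty_of_bounded ⟨x, hx⟩ hne hs ht.isBounded)⟩

variable (X Y) in
theorem exists_optimal_correspondence :
    ∃ (K : Set (X × Y)) (f : K → X) (g : K → Y), CompactSpace K ∧ Continuous f ∧ Continuous g ∧
      Function.Surjective f ∧ Function.Surjective g ∧
      ∀ k l, |dist (f k) (f l) - dist (g k) (g l)| ≤ 2 * ghDist X Y := by
  have hl := isometry_optimalGHInjl X Y
  have hr := isometry_optimalGHInjr X Y
  have hcl := isCompact_range hl.continuous
  have hcr := isCompact_range hr.continuous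
  let K : Set (X × Y) :=
    {p | dist (optimalGHInjl X Y p.1) (optimalGHInjr X Y p.2) ≤ ghDist X Y}
  have hK : IsClosed K := isClosed_le
    ((hl.continuous.comp continuous_fst).dist (hr.continuous.comp continuous_snd))
    continuous_const
  refine ⟨K, fun k => k.1.1, fun k => k.1.2, isCompact_iff_compactSpace.1 hK.isCompact,
    by fun_prop, by fun_prop, fun x => ?_, fun y => ?_, fun k l => ?_⟩
  · obtain ⟨_, ⟨y, rfl⟩, hxy⟩ := exists_dist_le_hausdorffDist hcl.isBounded hcr
      (Set.range_nonempty _) (Set.mem_range_self x)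
    exact ⟨⟨(x, y), hxy.trans_eq hausdorffDist_optimal⟩, rfl⟩
  · obtain ⟨_, ⟨x, rfl⟩, hyx⟩ := exists_dist_le_hausdorffDist hcr.isBounded hcl
      (Set.range_nonempty _) (Set.mem_range_self y)
    rw [dist_comm, Metric.hausdorffDist_comm, hausdorffDist_optimal] at hyx
    exact ⟨⟨(x, y), hyx⟩, rfl⟩
  · rw [← hl.dist_eq, ← hr.dist_eq, two_mul]
    exact (dist_dist_dist_le _ _ _ _).trans (add_le_add k.2 l.2)

end GromovHausdorff

section MetricQuotient

variable {W : Type*} {ρ τ : PseudoMetric W ℝ} {x y : GHSpace}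

/-- The isometry class `x` is that of the metric space obtained from `W` by identifying the points
at `ρ`-distance zero. -/
def IsMetricQuotient (ρ : PseudoMetric W ℝ) (x : GHSpace) : Prop :=
  ∃ π : W → x.Rep, Function.Surjective π ∧ ∀ v w, dist (π v) (π w) = ρ v w

theorem IsMetricQuotient.dist_le (hx : IsMetricQuotient ρ x) (hy : IsMetricQuotient τ y) {δ : ℝ}
    (h : ∀ v w, |ρ v w - τ v w| ≤ 2 * δ) : dist x y ≤ δ := by
  obtain ⟨f, hf, hfρ⟩ := hx
  obtain ⟨g, hg, hgτ⟩ := hy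
  rw [dist_ghDist]
  exact ghDist_le_of_surjective hf hg fun v w => by simpa only [hfρ, hgτ] using h v w

theorem IsMetricQuotient.unique (hx : IsMetricQuotient ρ x) (hy : IsMetricQuotient ρ y) : x = y :=
  dist_le_zero.1 (hx.dist_le hy fun v w => by simp)

variable [TopologicalSpace W] [CompactSpace W]

theorem exists_isMetricQuotient [Nonempty W] (hρ : Continuous fun p : W × W => ρ p.1 p.2) :
    ∃ x, IsMetricQuotient ρ x := by
  let P : PseudoMetricSpace W :=
    { dist := ρ
      dist_self := ρ.refl
      dist_comm := ρ.symm
      dist_triangle := ρ.triangle }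
  -- `V` carries the metric `ρ`, but inherits compactness from the finer given topology of `W`.
  let V := @SeparationQuotient W P.toUniformSpace.toTopologicalSpace
  let π : W → V := @SeparationQuotient.mk W P.toUniformSpace.toTopologicalSpace
  have hπ : Function.Surjective π := Quotient.mk_surjective
  have hdist : ∀ v w, dist (π v) (π w) = ρ v w := fun _ _ => rfl
  have hcont : Continuous π := by
    refine continuous_iff_continuousAt.2 fun w => tendsto_iff_dist_tendsto_zero.2 ?_
    have : Continuous fun v => ρ v w := hρ.comp (by fun_prop : Continuous fun v => (v, w))
    simpa only [hdist, ρ.refl] using this.tendsto w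
  have : CompactSpace V := hπ.compactSpace hcont
  have : Nonempty V := ‹Nonempty W›.map π
  obtain ⟨e⟩ := toGHSpace_eq_toGHSpace_iff_isometryEquiv.1 (toGHSpace V).toGHSpace_rep.symm
  exact ⟨toGHSpace V, e ∘ π, e.surjective.comp hπ, fun v w => (e.dist_eq _ _).trans (hdist v w)⟩

theorem continuous_of_isMetricQuotient {P : Type*} [TopologicalSpace P] {ρ : P → PseudoMetric W ℝ}
    (hρ : Continuous fun x : P × W × W => ρ x.1 x.2.1 x.2.2) {F : P → GHSpace}
    (hF : ∀ p, IsMetricQuotient (ρ p) (F p)) : Continuous F := by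
  let f : C(P, C(W × W, ℝ)) := ContinuousMap.curry ⟨_, hρ⟩
  have dist_F_le (p p' : P) : dist (F p) (F p') ≤ dist (f p) (f p') / 2 :=
    (hF p).dist_le (hF p') fun v w => by
      rw [mul_div_cancel₀ _ two_ne_zero]
      exact (f p).dist_apply_le_dist (g := f p') (v, w)
  refine continuous_iff_continuousAt.2 fun p => tendsto_iff_dist_tendsto_zero.2 ?_
  refine squeeze_zero (fun _ => dist_nonneg) (fun p' => dist_F_le p' p) ?_
  simpa using (tendsto_iff_dist_tendsto_zero.1 (f.continuous.tendsto p)).div_const 2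

end MetricQuotient

section Geodesic

variable {M : Type*} [MetricSpace M] {x y : M} {γ η : I → M}

theorem isGeodesic_of_dist_le (h0 : γ 0 = x) (h1 : γ 1 = y)
    (h : ∀ s t : I, dist (γ s) (γ t) ≤ |(s : ℝ) - t| * dist x y) : IsGeodesic x y γ where
  continuous := (LipschitzWith.of_dist_le_mul (K := nndist x y) fun s t =>
    (h s t).trans_eq (mul_comm _ _)).continuous
  source := h0
  target := h1
  dist_eq := by
    have dist_ge {s t : I} (hst : s ≤ t) : |(s : ℝ) - t| * dist x y ≤ dist (γ s) (γ t) := by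
      have h0s : dist (γ 0) (γ s) ≤ s * dist x y := by simpa [abs_of_nonneg s.2.1] using h 0 s
      have ht1 : dist (γ t) (γ 1) ≤ (1 - t) * dist x y := by
        simpa only [Set.Icc.coe_one, abs_sub_comm (t : ℝ), abs_of_nonneg (sub_nonneg.2 t.2.2)]
          using h t 1
      have hxy := dist_triangle4 (γ 0) (γ s) (γ t) (γ 1)
      have abs_eq : |(s : ℝ) - t| = t - s := by
        rw [abs_sub_comm, abs_of_nonneg (sub_nonneg.2 (show (s : ℝ) ≤ t from hst))]
      rw [← h0, ← h1] at h0s ht1 ⊢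
      rw [abs_eq]
      linarith
    intro s t
    refine (h s t).antisymm ?_
    rcases le_total s t with hst | hts
    · exact dist_ge hst
    · rw [abs_sub_comm, dist_comm (γ s)]
      exact dist_ge hts

theorem IsGeodesic.eq_of_apply_eq (hγ : IsGeodesic x y γ) (hη : IsGeodesic x y η) (hxy : x ≠ y)
    {s t : I} (h : γ s = η t) : s = t := by
  have hs := hγ.dist_eq s 0
  have ht := hη.dist_eq t 0
  rw [hγ.source] at hs
  rw [hη.source, ← h, hs] at ht
  have hst := mul_right_cancel₀ (dist_ne_zero.2 hxy) ht
  simpa [abs_of_nonneg s.2.1, abs_of_nonneg t.2.1, Subtype.ext_iff] using hst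

end Geodesic

section IsolationRadii

/-- The distances from isolated points to their nearest neighbours, as long as these are attained.
This isometry invariant serves to recover the parameter of a member of the bunch. -/
def isolationRadii {W : Type*} (ρ : W → W → ℝ) : Set ℝ :=
  {c | ∃ w, IsLeast (Set.range (ρ w) ∩ Set.Ioi 0) c}

theorem IsMetricQuotient.isolationRadii_eq {W : Type*} {ρ : PseudoMetric W ℝ} {x : GHSpace}
    (hx : IsMetricQuotient ρ x) : isolationRadii ρ = isolationRadii (dist : x.Rep → x.Rep → ℝ) := by
  obtain ⟨π, hπ, hρ⟩ := hx
  have range_eq (w : W) : Set.range (ρ w) = Set.range (dist (π w)) := by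
    rw [← hπ.range_comp]
    exact congrArg Set.range (funext fun v => (hρ w v).symm)
  ext c
  simp only [isolationRadii, Set.mem_ofPred_eq, range_eq, hπ.exists]

end IsolationRadii

section PerfectSpace

theorem exists_dist_lt_of_perfectSpace {Z : Type*} [MetricSpace Z] [PerfectSpace Z] (z : Z) {ε : ℝ}
    (hε : 0 < ε) : ∃ z', 0 < dist z z' ∧ dist z z' < ε := by
  have mem_ball : ∀ᶠ z' in 𝓝[≠] z, z' ∈ Metric.ball z ε :=
    mem_nhdsWithin_of_mem_nhds (Metric.ball_mem_nhds z hε)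
  obtain ⟨z', hz', hne⟩ := (mem_ball.and self_mem_nhdsWithin).exists
  exact ⟨z', dist_pos.2 (Ne.symm hne), Metric.mem_ball'.1 hz'⟩

theorem perfectSpace_prod_right {α β : Type*} [TopologicalSpace α] [TopologicalSpace β]
    [PerfectSpace β] : PerfectSpace (α × β) := by
  refine perfectSpace_iff_forall_not_isolated.2 fun ⟨a, b⟩ => ?_
  have slice_tendsto : Filter.Tendsto (Prod.mk a) (𝓝[≠] b) (𝓝[≠] (a, b)) :=
    (by fun_prop : Continuous (Prod.mk a)).continuousWithinAt.tendsto_nhdsWithin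
      fun b' hb' => (Prod.mk_right_injective a).ne hb'
  exact slice_tendsto.neBot

end PerfectSpace

section PseudoMetrics

variable {W X Y Z : Type*} [PseudoMetricSpace X] [PseudoMetricSpace Y] [PseudoMetricSpace Z]

/-- The pseudo-metric `(1 - s) d_X + s d_Y`, pulled back to `W` along `f` and `g`: along a
correspondence of least distortion it traces the straight-line geodesic. -/
def interpolatedDist (f : W → X) (g : W → Y) (s : I) : PseudoMetric W ℝ where
  toFun v w := (1 - s) * dist (f v) (f w) + s * dist (g v) (g w)
  refl' w := by simp
  symm' v w := by rw [dist_comm (f v), dist_comm (g v)]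
  triangle' u v w := by
    have hX := mul_le_mul_of_nonneg_left (dist_triangle (f u) (f v) (f w)) (sub_nonneg.2 s.2.2)
    have hY := mul_le_mul_of_nonneg_left (dist_triangle (g u) (g v) (g w)) s.2.1
    linarith

theorem interpolatedDist_apply (f : W → X) (g : W → Y) (s : I) (v w : W) :
    interpolatedDist f g s v w = (1 - s) * dist (f v) (f w) + s * dist (g v) (g w) := rfl

theorem abs_interpolatedDist_sub (f : W → X) (g : W → Y) (s t : I) (v w : W) :
    |interpolatedDist f g s v w - interpolatedDist f g t v w| =
      |(s : ℝ) - t| * |dist (f v) (f w) - dist (g v) (g w)| := by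
  rw [← abs_neg ((s : ℝ) - t), ← abs_mul, interpolatedDist_apply, interpolatedDist_apply]
  ring_nf

/-- The pseudo-metric `min d_Z c`, pulled back to `W` along `π`: it flattens `Z` to diameter at most
`c` without changing distances below `c`. -/
def truncatedDist (π : W → Z) (c : ℝ≥0) : PseudoMetric W ℝ where
  toFun v w := min (dist (π v) (π w)) c
  refl' w := by simp
  symm' v w := by rw [dist_comm]
  triangle' u v w := by
    have htri := dist_triangle (π u) (π v) (π w)
    have huv : 0 ≤ dist (π u) (π v) := dist_nonneg
    have hvw : 0 ≤ dist (π v) (π w) := dist_nonneg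
    have hc := c.coe_nonneg
    grind

theorem truncatedDist_apply (π : W → Z) (c : ℝ≥0) (v w : W) :
    truncatedDist π c v w = min (dist (π v) (π w)) c := rfl

theorem abs_truncatedDist_sub_le (π : W → Z) (b c : ℝ≥0) (v w : W) :
    |truncatedDist π b v w - truncatedDist π c v w| ≤ |(b : ℝ) - c| := by
  simpa [truncatedDist_apply] using
    abs_min_sub_min_le_max (dist (π v) (π w)) b (dist (π v) (π w)) c

end PseudoMetrics

section Comb

open Classical in
/-- The ultrametric of a comb: distinct points `v` and `w`, thought of as tips of teeth of heights
`h v` and `h w`, are at distance `max (h v) (h w)`. -/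
noncomputable def combDist {W : Type*} (h : W → ℝ≥0) : PseudoMetric W ℝ where
  toFun v w := if v = w then 0 else max (h v) (h w)
  refl' w := if_pos rfl
  symm' v w := by simp only [eq_comm (a := v), max_comm]
  triangle' u v w := by
    have hv := (h v).coe_nonneg
    have hu := (h u).coe_nonneg
    grind

variable {W : Type*} {h k : W → ℝ≥0} {v w : W}

theorem combDist_of_ne (hvw : v ≠ w) : combDist h v w = max (h v : ℝ) (h w) := if_neg hvw

theorem combDist_le_max : combDist h v w ≤ max (h v : ℝ) (h w) := by
  rcases eq_or_ne v w with rfl | hvw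
  · simp
  · exact (combDist_of_ne hvw).le

theorem combDist_eq_zero (hv : h v = 0) (hw : h w = 0) : combDist h v w = 0 :=
  le_antisymm (combDist_le_max.trans (by simp [hv, hw])) ((combDist h).nonneg v w)

theorem abs_combDist_sub_le {δ : ℝ} (hhk : ∀ u, |(h u : ℝ) - k u| ≤ δ) (v w : W) :
    |combDist h v w - combDist k v w| ≤ δ := by
  rcases eq_or_ne v w with rfl | hvw
  · simpa using (abs_nonneg _).trans (hhk v)
  · rw [combDist_of_ne hvw, combDist_of_ne hvw]
    exact (abs_max_sub_max_le_max ..).trans (max_le (hhk v) (hhk w))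

theorem continuous_combDist {P : Type*} [TopologicalSpace P] [TopologicalSpace W] [T2Space W]
    {h : P → W → ℝ≥0} (hh : Continuous fun x : P × W => h x.1 x.2)
    (hW : ∀ w, IsOpen {w} ∨ ∀ p, h p w = 0) :
    Continuous fun x : P × W × W => combDist (h x.1) x.2.1 x.2.2 := by
  have max_cont : Continuous fun x : P × W × W => max (h x.1 x.2.1 : ℝ) (h x.1 x.2.2) := by
    have h₁ := hh.comp (by fun_prop : Continuous fun x : P × W × W => (x.1, x.2.1))
    have h₂ := hh.comp (by fun_prop : Continuous fun x : P × W × W => (x.1, x.2.2))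
    exact (NNReal.continuous_coe.comp h₁).max (NNReal.continuous_coe.comp h₂)
  refine continuous_iff_continuousAt.2 ?_
  rintro ⟨p, v, w⟩
  rcases eq_or_ne v w with rfl | hvw
  · rcases hW v with hv | hv
    · have eventually_diag : ∀ᶠ x : P × W × W in 𝓝 (p, v, v), x.2.1 = v ∧ x.2.2 = v :=
        ((hv.preimage (by fun_prop : Continuous fun x : P × W × W => x.2.1)).inter
          (hv.preimage (by fun_prop : Continuous fun x : P × W × W => x.2.2))).mem_nhds ⟨rfl, rfl⟩
      refine (continuousAt_const (y := (0 : ℝ))).congr (eventually_diag.mono ?_)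
      rintro ⟨p', v', w'⟩ ⟨hv', hw'⟩
      dsimp only at hv' hw' ⊢
      rw [hv', hw', (combDist _).refl]
    · have lim_max := max_cont.tendsto (p, v, v)
      simp only [hv p, NNReal.coe_zero, max_self] at lim_max
      rw [ContinuousAt, (combDist _).refl]
      exact squeeze_zero (fun _ => (combDist _).nonneg _ _) (fun _ => combDist_le_max) lim_max
  · have eventually_ne : ∀ᶠ x : P × W × W in 𝓝 (p, v, w), x.2.1 ≠ x.2.2 :=
      (isOpen_ne_fun (by fun_prop) (by fun_prop)).mem_nhds hvw
    exact max_cont.continuousAt.congr (eventually_ne.mono fun x hx => (combDist_of_ne hx).symm)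

theorem isLeast_sup_combDist {ρ : PseudoMetric W ℝ} (hw : h w ≠ 0)
    (hbase : ∃ v, h v = 0 ∧ ρ w v = 0) :
    IsLeast (Set.range ((ρ ⊔ combDist h) w) ∩ Set.Ioi 0) (h w) := by
  obtain ⟨v, hv, hρ⟩ := hbase
  have hne : w ≠ v := by
    rintro rfl
    exact hw hv
  refine ⟨⟨⟨v, ?_⟩, NNReal.coe_pos.2 (pos_iff_ne_zero.2 hw)⟩, ?_⟩
  · simp [PseudoMetric.sup_apply, combDist_of_ne hne, hv, hρ]
  · rintro _ ⟨⟨u, rfl⟩, hu⟩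
    have hwu : w ≠ u := by
      rintro rfl
      exact hu.ne' ((ρ ⊔ combDist h).refl w)
    rw [PseudoMetric.sup_apply, combDist_of_ne hwu]
    exact (le_max_left _ _).trans (le_max_right _ _)

/-- A point of height zero is not isolated, by `hperfect`; a tip of positive height is nearest
to the points of height zero on which it projects. -/
theorem isolationRadii_sup_combDist {ρ : PseudoMetric W ℝ}
    (hperfect : ∀ v, h v = 0 → ∀ ε > 0, ∃ w, h w = 0 ∧ 0 < ρ v w ∧ ρ v w < ε)
    (hbase : ∀ v, ∃ w, h w = 0 ∧ ρ v w = 0) :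
    isolationRadii ⇑(ρ ⊔ combDist h) = (↑) '' (Set.range h \ {0}) := by
  ext c
  constructor
  · rintro ⟨w, hw⟩
    by_cases hw0 : h w = 0
    · obtain ⟨v, hv, hpos, hlt⟩ := hperfect w hw0 c hw.1.2
      have hmax : (ρ ⊔ combDist h) w v = ρ w v := by
        rw [PseudoMetric.sup_apply, sup_eq_left]
        exact combDist_le_max.trans (by simpa [hw0, hv] using hpos.le)
      exact absurd (hw.2 ⟨⟨v, rfl⟩, hmax ▸ hpos⟩) (by rw [hmax]; exact hlt.not_ge)
    · exact ⟨h w, ⟨⟨w, rfl⟩, hw0⟩, (isLeast_sup_combDist hw0 (hbase w)).unique hw⟩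
  · rintro ⟨_, ⟨⟨w, rfl⟩, hw0⟩, rfl⟩
    exact ⟨w, isLeast_sup_combDist hw0 (hbase w)⟩

end Comb

section Labels

/-- The `n`-th coordinate of a point `q` of the Hilbert cube, encoded in
`[4⁻⁽ⁿ⁺¹⁾, 2 · 4⁻⁽ⁿ⁺¹⁾]`. These intervals are disjoint for different `n`. -/
noncomputable def labelRadius (q : HilbertCube) (n : ℕ) : ℝ≥0 :=
  4⁻¹ ^ (n + 1) * (1 + unitInterval.toNNReal (q n))

variable {q q' : HilbertCube} {m n : ℕ}

theorem le_labelRadius : 4⁻¹ ^ (n + 1) ≤ labelRadius q n :=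
  le_mul_of_one_le_right' le_self_add

theorem labelRadius_lt : labelRadius q n < 4⁻¹ ^ n := by
  have toNNReal_le_one : unitInterval.toNNReal (q n) ≤ 1 := (q n).2.2
  calc labelRadius q n ≤ 4⁻¹ ^ (n + 1) * (1 + 1) := by
        unfold labelRadius
        gcongr
    _ = 4⁻¹ ^ n * 2⁻¹ := by rw [pow_succ, mul_assoc]; norm_num
    _ < 4⁻¹ ^ n := mul_lt_of_lt_one_right (by positivity) (by norm_num)

theorem labelRadius_lt_labelRadius (hmn : m < n) : labelRadius q n < labelRadius q' m :=
  labelRadius_lt.trans_le <| (pow_le_pow_of_le_one zero_le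
    (inv_le_one_of_one_le₀ (by norm_num)) hmn).trans le_labelRadius

theorem eq_of_labelRadius_eq (h : labelRadius q n = labelRadius q' m) : n = m := by
  rcases lt_trichotomy n m with hnm | hnm | hnm
  · exact absurd h (labelRadius_lt_labelRadius hnm).ne'
  · exact hnm
  · exact absurd h (labelRadius_lt_labelRadius hnm).ne

theorem injective_range_labelRadius :
    Function.Injective fun q => Set.range (labelRadius q) := by
  intro q q' hqq'
  funext n
  obtain ⟨m, hm⟩ := hqq'.subset (Set.mem_range_self n)
  obtain rfl := eq_of_labelRadius_eq hm
  have toNNReal_eq : unitInterval.toNNReal (q m) = unitInterval.toNNReal (q' m) := by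
    simpa [labelRadius] using hm.symm
  exact Subtype.ext (congrArg NNReal.toReal toNNReal_eq)

/-- The heights of the teeth labelled by `q`, indexed so that the teeth shrink towards the tooth
`∞` of height zero. -/
noncomputable def labelHeight (q : HilbertCube) (a : OnePoint ℕ) : ℝ≥0 :=
  a.elim 0 (labelRadius q)

theorem labelHeight_le (a : OnePoint ℕ) : labelHeight q a ≤ a.elim 0 (4⁻¹ ^ ·) := by
  induction a using OnePoint.rec with
  | infty => exact le_rfl
  | coe n => exact labelRadius_lt.le

theorem labelHeight_le_one (a : OnePoint ℕ) : labelHeight q a ≤ 1 := by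
  induction a using OnePoint.rec with
  | infty => exact zero_le_one
  | coe n => exact labelRadius_lt.le.trans <|
      pow_le_one₀ zero_le (inv_le_one_of_one_le₀ (by norm_num))

theorem continuous_labelHeight :
    Continuous fun x : HilbertCube × OnePoint ℕ => labelHeight x.1 x.2 := by
  refine continuous_iff_continuousAt.2 ?_
  rintro ⟨q, a⟩
  induction a using OnePoint.rec with
  | infty =>
    have bound_cont : Continuous fun a : OnePoint ℕ => a.elim (0 : ℝ≥0) (4⁻¹ ^ ·) :=
      (OnePoint.continuous_iff_from_nat _).2
        (tendsto_pow_atTop_nhds_zero_of_lt_one zero_le (by norm_num))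
    exact tendsto_of_tendsto_of_tendsto_of_le_of_le tendsto_const_nhds
      ((bound_cont.comp continuous_snd).tendsto (q, OnePoint.infty)) (fun _ => zero_le)
      fun x => labelHeight_le x.2
  | coe n =>
    have radius_cont : Continuous fun x : HilbertCube × ℕ => labelRadius x.1 x.2 :=
      continuous_prod_of_discrete_right.2 fun n => by
        unfold labelRadius
        fun_prop
    exact (Topology.IsOpenEmbedding.id.prodMap OnePoint.isOpenEmbedding_coe).continuousAt_iff
      (x := (q, n)) |>.1 radius_cont.continuousAt

end Labels

section BunchSpace

variable {K X Y Z : Type*}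

/-- The product `K × Z` of a correspondence and a perfect space, together with the one-point
compactification of `ℕ`, whose points are the tips of the teeth of a comb. -/
abbrev BunchSpace (K Z : Type*) : Type _ := (K × Z) ⊕ OnePoint ℕ

/-- The projection of `BunchSpace K Z` to `K × Z` that attaches all teeth at `b`. -/
def position (b : K × Z) : BunchSpace K Z → K × Z := Sum.elim id fun _ => b

/-- The index of a tooth in `BunchSpace K Z`; the points of `K × Z` get the index `∞` of the tooth
of height zero. -/
def toothIndex : BunchSpace K Z → OnePoint ℕ := Sum.elim (fun _ => OnePoint.infty) id

/-- The largest `Z`-distance visible at time `s`: it vanishes at the endpoints and is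
`2 r`-Lipschitz, the rate at which distances may change along a geodesic of length `r`. -/
noncomputable def truncation (r : ℝ≥0) (s : I) : ℝ≥0 :=
  2 * r * min (unitInterval.toNNReal s) (unitInterval.toNNReal (unitInterval.symm s))

/-- The height of a tooth of the comb at the parameter `p`: it vanishes at times in `A`. -/
noncomputable def toothHeight (A : Set I) (r : ℝ≥0) (p : I × HilbertCube) (w : BunchSpace K Z) :
    ℝ≥0 :=
  2 * r * Metric.infNndist p.1 A * labelHeight p.2 (toothIndex w)

section Truncation

variable {r : ℝ≥0} {s t : I}

theorem truncation_zero : truncation r 0 = 0 := by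
  simp [truncation]

theorem truncation_one : truncation r 1 = 0 := by
  simp [truncation]

theorem truncation_pos (hr : 0 < r) (h0 : s ≠ 0) (h1 : s ≠ 1) : 0 < truncation r s := by
  have hs : 0 < unitInterval.toNNReal s := unitInterval.pos_iff_ne_zero.2 h0
  have hs' : 0 < unitInterval.toNNReal (unitInterval.symm s) :=
    unitInterval.pos_iff_ne_zero.2 (unitInterval.symm_eq_zero.not.2 h1)
  unfold truncation
  positivity

theorem abs_truncation_sub_le :
    |(truncation r s : ℝ) - truncation r t| ≤ 2 * (|(s : ℝ) - t| * r) := by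
  have abs_min_sub_le : |min (s : ℝ) (1 - s) - min (t : ℝ) (1 - t)| ≤ |(s : ℝ) - t| :=
    (abs_min_sub_min_le_max ..).trans_eq <| by
      rw [sub_sub_sub_cancel_left, abs_sub_comm (t : ℝ), max_self]
  simp only [truncation, NNReal.coe_mul, NNReal.coe_min, NNReal.coe_ofNat,
    unitInterval.coe_toNNReal, unitInterval.coe_symm_eq, ← mul_sub, abs_mul, NNReal.abs_eq,
    Nat.abs_ofNat]
  calc 2 * r * |min (s : ℝ) (1 - s) - min (t : ℝ) (1 - t)|
      ≤ 2 * r * |(s : ℝ) - t| := by gcongr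
    _ = 2 * (|(s : ℝ) - t| * r) := by ring

theorem continuous_truncation : Continuous (truncation r) := by
  unfold truncation
  fun_prop

end Truncation

section ToothHeight

variable {A : Set I} {r : ℝ≥0} {s t : I} {p : I × HilbertCube}

theorem toothHeight_of_mem {q : HilbertCube} (hs : s ∈ A) (w : BunchSpace K Z) :
    toothHeight A r (s, q) w = 0 := by
  have : Metric.infNndist s A = 0 := NNReal.eq (Metric.infDist_zero_of_mem hs)
  simp [toothHeight, this]

theorem toothHeight_inl (u : K × Z) : toothHeight A r p (Sum.inl u) = 0 := mul_zero _

theorem abs_toothHeight_sub_le {q : HilbertCube} (w : BunchSpace K Z) :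
    |(toothHeight A r (s, q) w : ℝ) - toothHeight A r (t, q) w| ≤ 2 * (|(s : ℝ) - t| * r) := by
  have abs_infDist_sub_le : |Metric.infDist s A - Metric.infDist t A| ≤ |(s : ℝ) - t| := by
    simpa [Real.dist_eq, Subtype.dist_eq] using (Metric.lipschitz_infDist_pt A).dist_le_mul s t
  have height_le_one : (labelHeight q (toothIndex w) : ℝ) ≤ 1 := labelHeight_le_one _
  simp only [toothHeight, NNReal.coe_mul, NNReal.coe_ofNat, Metric.coe_infNndist, ← sub_mul,
    ← mul_sub, abs_mul, NNReal.abs_eq, Nat.abs_ofNat]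
  calc 2 * r * |Metric.infDist s A - Metric.infDist t A| * labelHeight q (toothIndex w)
      ≤ 2 * r * |(s : ℝ) - t| * 1 := by gcongr
    _ = 2 * (|(s : ℝ) - t| * r) := by ring

theorem isOpen_singleton_or_toothHeight_eq_zero [TopologicalSpace K] [TopologicalSpace Z]
    (w : BunchSpace K Z) :
    IsOpen {w} ∨ ∀ p, toothHeight A r p w = 0 := by
  rcases w with u | a
  · exact .inr fun p => toothHeight_inl u
  · induction a using OnePoint.rec with
    | infty => exact .inr fun p => mul_zero _
    | coe n =>
      left
      simpa using (Topology.IsOpenEmbedding.inr.comp OnePoint.isOpenEmbedding_coe).isOpenMap {n}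
        (isOpen_discrete _)

theorem continuous_toothHeight [TopologicalSpace K] [TopologicalSpace Z] :
    Continuous fun x : (I × HilbertCube) × BunchSpace K Z => toothHeight A r x.1 x.2 := by
  have index_cont : Continuous (toothIndex : BunchSpace K Z → OnePoint ℕ) :=
    continuous_const.sumElim continuous_id
  have label_cont : Continuous fun x : (I × HilbertCube) × BunchSpace K Z =>
      labelHeight x.1.2 (toothIndex x.2) :=
    continuous_labelHeight.comp ((continuous_snd.comp continuous_fst).prodMk
      (index_cont.comp continuous_snd))
  unfold toothHeight
  fun_prop

theorem range_toothHeight_diff {q : HilbertCube} (hr : 0 < r) (hA : IsClosed A) (hne : A.Nonempty)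
    (hs : s ∉ A) :
    Set.range (toothHeight A r (s, q) : BunchSpace K Z → ℝ≥0) \ {0} =
      (2 * r * Metric.infNndist s A * ·) '' Set.range (labelRadius q) := by
  have infNndist_pos : 0 < Metric.infNndist s A := (hA.notMem_iff_infDist_pos hne).1 hs
  ext c
  constructor
  · rintro ⟨⟨u | a, rfl⟩, hc⟩
    · exact absurd (toothHeight_inl u) hc
    · induction a using OnePoint.rec with
      | infty => exact absurd (mul_zero _) hc
      | coe n => exact ⟨_, ⟨n, rfl⟩, rfl⟩
  · rintro ⟨_, ⟨n, rfl⟩, rfl⟩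
    have radius_pos : 0 < labelRadius q n := lt_of_lt_of_le (by positivity) le_labelRadius
    refine ⟨⟨Sum.inr (n : OnePoint ℕ), rfl⟩, ?_⟩
    exact (by positivity : 0 < 2 * r * Metric.infNndist s A * labelRadius q n).ne'

end ToothHeight

variable [PseudoMetricSpace X] [PseudoMetricSpace Y] [PseudoMetricSpace Z]

/-- The part of `bunchMetric` that only depends on the time `s`. -/
noncomputable def trunkMetric (f : K → X) (g : K → Y) (b : K × Z) (r : ℝ≥0) (s : I) :
    PseudoMetric (BunchSpace K Z) ℝ :=
  interpolatedDist (fun w => f (position b w).1) (fun w => g (position b w).1) s ⊔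
    truncatedDist (fun w => (position b w).2) (truncation r s)

/-- The pseudo-metric on `BunchSpace K Z` whose quotient is the member of the bunch with parameter
`p`. The comb encodes the point `p.2` of the Hilbert cube. -/
noncomputable def bunchMetric (f : K → X) (g : K → Y) (b : K × Z) (A : Set I) (r : ℝ≥0)
    (p : I × HilbertCube) : PseudoMetric (BunchSpace K Z) ℝ :=
  trunkMetric f g b r p.1 ⊔ combDist (toothHeight A r p)

section BunchMetric

variable {f : K → X} {g : K → Y} {b : K × Z} {A : Set I} {r : ℝ≥0} {s t : I}

theorem trunkMetric_zero (v w : BunchSpace K Z) :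
    trunkMetric f g b r 0 v w = dist (f (position b v).1) (f (position b w).1) := by
  simp [trunkMetric, PseudoMetric.sup_apply, interpolatedDist_apply, truncatedDist_apply,
    truncation_zero]

theorem trunkMetric_one (v w : BunchSpace K Z) :
    trunkMetric f g b r 1 v w = dist (g (position b v).1) (g (position b w).1) := by
  simp [trunkMetric, PseudoMetric.sup_apply, interpolatedDist_apply, truncatedDist_apply,
    truncation_one]

theorem trunkMetric_position (v : BunchSpace K Z) (u : K × Z) :
    trunkMetric f g b r s v (Sum.inl u) =
      trunkMetric f g b r s (Sum.inl (position b v)) (Sum.inl u) := rfl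

theorem trunkMetric_inl_inl (k : K) (z z' : Z) :
    trunkMetric f g b r s (Sum.inl (k, z)) (Sum.inl (k, z')) =
      min (dist z z') (truncation r s) := by
  simp [trunkMetric, position, PseudoMetric.sup_apply, interpolatedDist_apply, truncatedDist_apply]

theorem bunchMetric_of_mem {q : HilbertCube} (hs : s ∈ A) :
    bunchMetric f g b A r (s, q) = trunkMetric f g b r s := by
  refine DFunLike.ext _ _ fun v => funext fun w => ?_
  rw [bunchMetric, PseudoMetric.sup_apply,
    combDist_eq_zero (toothHeight_of_mem hs v) (toothHeight_of_mem hs w),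
    sup_of_le_left (PseudoMetric.nonneg _ _ _)]

theorem bunchMetric_inl_inl {p : I × HilbertCube} (k : K) (z z' : Z) :
    bunchMetric f g b A r p (Sum.inl (k, z)) (Sum.inl (k, z')) =
      min (dist z z') (truncation r p.1) := by
  rw [bunchMetric, PseudoMetric.sup_apply, trunkMetric_inl_inl,
    combDist_eq_zero (toothHeight_inl _) (toothHeight_inl _),
    sup_of_le_left (le_min dist_nonneg (NNReal.coe_nonneg _))]

theorem abs_bunchMetric_sub_le (hfg : ∀ k l, |dist (f k) (f l) - dist (g k) (g l)| ≤ 2 * r)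
    {q : HilbertCube} (v w : BunchSpace K Z) :
    |bunchMetric f g b A r (s, q) v w - bunchMetric f g b A r (t, q) v w| ≤
      2 * (|(s : ℝ) - t| * r) := by
  simp only [bunchMetric, trunkMetric, PseudoMetric.sup_apply]
  refine (abs_max_sub_max_le_max ..).trans
    (max_le ((abs_max_sub_max_le_max ..).trans (max_le ?_ ?_)) ?_)
  · rw [abs_interpolatedDist_sub, mul_left_comm]
    exact mul_le_mul_of_nonneg_left (hfg _ _) (abs_nonneg _)
  · exact (abs_truncatedDist_sub_le ..).trans abs_truncation_sub_le
  · exact abs_combDist_sub_le abs_toothHeight_sub_le v w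

end BunchMetric

end BunchSpace

section BunchParameter

variable {K X Y Z : Type*} [PseudoMetricSpace X] [PseudoMetricSpace Y] [MetricSpace Z]
  {f : K → X} {g : K → Y} {b : K × Z} {A : Set I} {r : ℝ≥0} {s : I}

theorem continuous_bunchMetric [TopologicalSpace K] [T2Space K] (hf : Continuous f)
    (hg : Continuous g) :
    Continuous fun x : (I × HilbertCube) × BunchSpace K Z × BunchSpace K Z =>
      bunchMetric f g b A r x.1 x.2.1 x.2.2 := by
  have position_cont : Continuous (position b) := continuous_id.sumElim continuous_const
  have truncation_cont := continuous_truncation (r := r)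
  have comb_cont := continuous_combDist (continuous_toothHeight (A := A) (r := r) (K := K) (Z := Z))
    isOpen_singleton_or_toothHeight_eq_zero
  simp only [bunchMetric, trunkMetric, PseudoMetric.sup_apply, interpolatedDist_apply,
    truncatedDist_apply]
  refine .max (.max ?_ ?_) comb_cont
  · fun_prop
  · fun_prop

theorem exists_trunkMetric_lt [PerfectSpace Z] (hr : 0 < r) (h0 : s ≠ 0) (h1 : s ≠ 1)
    (v : BunchSpace K Z) {ε : ℝ} (hε : 0 < ε) :
    ∃ u : K × Z, 0 < trunkMetric f g b r s v (Sum.inl u) ∧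
      trunkMetric f g b r s v (Sum.inl u) < ε := by
  obtain ⟨z, hz, hzε⟩ := exists_dist_lt_of_perfectSpace (position b v).2 hε
  refine ⟨((position b v).1, z), ?_⟩
  rw [trunkMetric_position, trunkMetric_inl_inl]
  exact ⟨lt_min hz (truncation_pos hr h0 h1), (min_le_left _ _).trans_lt hzε⟩

theorem isolationRadii_bunchMetric [PerfectSpace Z] {q : HilbertCube} (hr : 0 < r) (hA : IsClosed A)
    (h0 : 0 ∈ A) (h1 : 1 ∈ A) (hs : s ∉ A) :
    isolationRadii ⇑(bunchMetric f g b A r (s, q)) =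
      (fun c => ((2 * r * Metric.infNndist s A * c : ℝ≥0) : ℝ)) '' Set.range (labelRadius q) := by
  have hs0 : s ≠ 0 := ne_of_mem_of_not_mem h0 hs |>.symm
  have hs1 : s ≠ 1 := ne_of_mem_of_not_mem h1 hs |>.symm
  rw [bunchMetric, isolationRadii_sup_combDist, range_toothHeight_diff hr hA ⟨0, h0⟩ hs,
    Set.image_image]
  · intro v _ ε hε
    obtain ⟨u, hu⟩ := exists_trunkMetric_lt (f := f) (g := g) hr hs0 hs1 v hε
    exact ⟨Sum.inl u, toothHeight_inl u, hu⟩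
  · exact fun v => ⟨Sum.inl (position b v), toothHeight_inl _,
      (trunkMetric_position v _).trans (PseudoMetric.refl _ _)⟩

theorem eq_of_isolationRadii_bunchMetric_eq [PerfectSpace Z] {q q' : HilbertCube} (hr : 0 < r)
    (hA : IsClosed A) (h0 : 0 ∈ A) (h1 : 1 ∈ A) (hs : s ∉ A)
    (h : isolationRadii ⇑(bunchMetric f g b A r (s, q)) =
      isolationRadii ⇑(bunchMetric f g b A r (s, q'))) : q = q' := by
  have infNndist_pos : 0 < Metric.infNndist s A := (hA.notMem_iff_infDist_pos ⟨0, h0⟩).1 hs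
  rw [isolationRadii_bunchMetric hr hA h0 h1 hs, isolationRadii_bunchMetric hr hA h0 h1 hs] at h
  refine injective_range_labelRadius (Set.image_injective.2 ?_ h)
  exact NNReal.coe_injective.comp (mul_right_injective₀ (by positivity))

end BunchParameter

section BranchingBunch

variable {K Z : Type*} {x y : GHSpace} {f : K → x.Rep} {g : K → y.Rep} {b : K × Z}

theorem isMetricQuotient_trunkMetric_zero [PseudoMetricSpace Z] {r : ℝ≥0}
    (hf : Function.Surjective f) :
    IsMetricQuotient (trunkMetric f g b r 0) x :=
  ⟨fun w => f (position b w).1, fun u => (hf u).imp' (fun k => Sum.inl (k, b.2)) fun _ => id,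
    fun v w => (trunkMetric_zero v w).symm⟩

theorem isMetricQuotient_trunkMetric_one [PseudoMetricSpace Z] {r : ℝ≥0}
    (hg : Function.Surjective g) :
    IsMetricQuotient (trunkMetric f g b r 1) y :=
  ⟨fun w => g (position b w).1, fun u => (hg u).imp' (fun k => Sum.inl (k, b.2)) fun _ => id,
    fun v w => (trunkMetric_one v w).symm⟩

theorem isBranchingBunch_of_isMetricQuotient [TopologicalSpace K] [CompactSpace K] [T2Space K]
    [MetricSpace Z] [CompactSpace Z] [PerfectSpace Z] {A : Set I} {F : I × HilbertCube → GHSpace}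
    (hf : Continuous f) (hg : Continuous g)
    (hf_surj : Function.Surjective f) (hg_surj : Function.Surjective g)
    (hfg : ∀ k l, |dist (f k) (f l) - dist (g k) (g l)| ≤ 2 * dist x y)
    (hxy : 0 < dist x y) (hA : IsClosed A) (h0 : 0 ∈ A) (h1 : 1 ∈ A)
    (hF : ∀ p, IsMetricQuotient (bunchMetric f g b A (nndist x y) p) (F p)) :
    IsBranchingBunch A x y F := by
  have trunk_quotient {s : I} (hs : s ∈ A) (q : HilbertCube) :
      IsMetricQuotient (trunkMetric f g b (nndist x y) s) (F (s, q)) := by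
    simpa only [bunchMetric_of_mem hs] using hF (s, q)
  have source (q : HilbertCube) : F (0, q) = x :=
    (trunk_quotient h0 q).unique (isMetricQuotient_trunkMetric_zero hf_surj)
  have target (q : HilbertCube) : F (1, q) = y :=
    (trunk_quotient h1 q).unique (isMetricQuotient_trunkMetric_one hg_surj)
  have geodesic (q : HilbertCube) : IsGeodesic x y fun s => F (s, q) :=
    isGeodesic_of_dist_le (source q) (target q) fun s t =>
      (hF (s, q)).dist_le (hF (t, q)) (abs_bunchMetric_sub_le hfg)
  refine
    { continuous := continuous_of_isMetricQuotient (continuous_bunchMetric hf hg) hF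
      endpoints := fun q => ⟨source q, target q⟩
      eq_on := fun s hs q q' => (trunk_quotient hs q).unique (trunk_quotient hs q')
      geodesic := geodesic
      ne_off := fun s t q q' hs _ hne h => ?_ }
  obtain rfl : s = t := (geodesic q).eq_of_apply_eq (geodesic q') (dist_pos.1 hxy) h
  have radii_eq := (hF (s, q)).isolationRadii_eq
  rw [h, ← (hF (s, q')).isolationRadii_eq] at radii_eq
  exact hne (congrArg (Prod.mk s) (eq_of_isolationRadii_bunchMetric_eq hxy hA h0 h1 hs radii_eq))

end BranchingBunch

section CountableProduct

open scoped PiCountable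

theorem isometry_update_of_dist_le {ι : Type*} [Encodable ι] [DecidableEq ι] {V : ι → Type*}
    [∀ i, MetricSpace (V i)] (z : ∀ i, V i) {i : ι}
    (hi : ∀ v w : V i, dist v w ≤ 2⁻¹ ^ Encodable.encode i) : Isometry (Function.update z i) := by
  refine Isometry.of_dist_eq fun v w => ?_
  calc dist (Function.update z i v) (Function.update z i w)
      = min (2⁻¹ ^ Encodable.encode i) (dist v w) := by
        rw [PiCountable.dist_eq_tsum, tsum_eq_single i fun j hj => by
          simp [Function.update_of_ne hj]]
        simp only [Function.update_self]
    _ = dist v w := min_eq_right (hi v w)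

end CountableProduct

section InfiniteSubspaces

variable {D : GHSpace → ℝ≥0∞} {Z : Type*} [PseudoMetricSpace Z]

/-- `Z` contains isometric copies of arbitrarily small compact spaces at which `D` is infinite. -/
def HasSmallInfiniteSubspaces (D : GHSpace → ℝ≥0∞) (Z : Type*) [PseudoMetricSpace Z] : Prop :=
  ∀ ε : ℝ, 0 < ε → ∃ (V : Type) (_ : MetricSpace V) (_ : CompactSpace V) (_ : Nonempty V)
    (ι : V → Z), D (toGHSpace V) = ⊤ ∧ Isometry ι ∧ ∀ v w : V, dist v w ≤ ε

theorem HasSmallInfiniteSubspaces.of_isometry {Z' : Type*} [PseudoMetricSpace Z']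
    (hZ : HasSmallInfiniteSubspaces D Z) {f : Z → Z'} (hf : Isometry f) :
    HasSmallInfiniteSubspaces D Z' := fun ε hε =>
  let ⟨V, _, _, _, ι, hV, hι, hdist⟩ := hZ ε hε
  ⟨V, _, ‹_›, ‹_›, f ∘ ι, hV, hf.comp hι, hdist⟩

namespace IsDimensionalFunction

theorem le_of_isometry (hD : IsDimensionalFunction D) {V : Type} [MetricSpace V] [CompactSpace V]
    [Nonempty V] {x : GHSpace} {f : V → x.Rep} (hf : Isometry f) : D (toGHSpace V) ≤ D x := by
  have range_le := hD.mono x.Rep (Set.range f) (isCompact_range hf.continuous).isClosed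
    (Set.range_nonempty f)
  rw [x.toGHSpace_rep] at range_le
  refine le_of_eq_of_le (congrArg D ?_) range_le
  exact toGHSpace_eq_toGHSpace_iff_isometryEquiv.2 ⟨hf.isometryEquivOnRange⟩

theorem mem_infiniteSet (hD : IsDimensionalFunction D) (hZ : HasSmallInfiniteSubspaces D Z)
    {W : Type*} {ρ : PseudoMetric W ℝ} {x : GHSpace} (hx : IsMetricQuotient ρ x) {j : Z → W} {c : ℝ}
    (hc : 0 < c) (hj : ∀ z z', dist z z' ≤ c → ρ (j z) (j z') = dist z z') :
    x ∈ infiniteSet D := by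
  obtain ⟨V, _, _, _, ι, hV, hι, hdist⟩ := hZ c hc
  obtain ⟨π, -, hπ⟩ := hx
  have isometry_comp : Isometry (π ∘ j ∘ ι) := Isometry.of_dist_eq fun v w =>
    calc dist (π (j (ι v))) (π (j (ι w))) = dist (ι v) (ι w) := by
          rw [hπ, hj _ _ ((hι.dist_eq v w).trans_le (hdist v w))]
      _ = dist v w := hι.dist_eq v w
  exact top_le_iff.1 (hV.symm.trans_le (hD.le_of_isometry isometry_comp))

open scoped PiCountable in
theorem exists_hasSmallInfiniteSubspaces (hD : IsDimensionalFunction D) :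
    ∃ (Z : Type) (_ : MetricSpace Z), CompactSpace Z ∧ Nonempty Z ∧
      HasSmallInfiniteSubspaces D Z := by
  choose V _ _ _ hV hdiam using fun n : ℕ => hD.small (2⁻¹ ^ n) (by positivity)
  have dist_le (n : ℕ) (v w : V n) : dist v w ≤ 2⁻¹ ^ n :=
    (Metric.dist_le_diam_of_mem isCompact_univ.isBounded trivial trivial).trans (hdiam n)
  refine ⟨∀ n, V n, PiCountable.metricSpace, inferInstance, inferInstance, fun ε hε => ?_⟩
  obtain ⟨n, hn⟩ := exists_pow_lt_of_lt_one hε (by norm_num : (2⁻¹ : ℝ) < 1)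
  exact ⟨V n, _, inferInstance, inferInstance, Function.update (fun _ => Classical.arbitrary _) n,
    hV n, isometry_update_of_dist_le _ (dist_le n), fun v w => (dist_le n v w).trans hn.le⟩

theorem exists_perfectSpace_hasSmallInfiniteSubspaces (hD : IsDimensionalFunction D) :
    ∃ (Z : Type) (_ : MetricSpace Z), CompactSpace Z ∧ Nonempty Z ∧ PerfectSpace Z ∧
      HasSmallInfiniteSubspaces D Z := by
  obtain ⟨Z, _, _, _, hZ⟩ := hD.exists_hasSmallInfiniteSubspaces
  have slice_isometry : Isometry fun z : Z => (z, (0 : I)) :=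
    Isometry.of_dist_eq fun z z' => by simp [Prod.dist_eq]
  exact ⟨Z × I, inferInstance, inferInstance, inferInstance, perfectSpace_prod_right,
    hZ.of_isometry slice_isometry⟩

end IsDimensionalFunction

end InfiniteSubspaces

theorem mainTheorem4 (D : GHSpace → ℝ≥0∞) (hD : IsDimensionalFunction D)
    (x y : GHSpace) (hx : x ∈ infiniteSet D) (hy : y ∈ infiniteSet D) (hxy : 0 < dist x y)
    (A : Set I) (hA : IsClosed A) (h0 : (0 : I) ∈ A) (h1 : (1 : I) ∈ A) :
    ∃ F : I × HilbertCube → GHSpace,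
      IsBranchingBunch A x y F ∧ ∀ p : I × HilbertCube, F p ∈ infiniteSet D := by
  obtain ⟨Z, _, _, _, _, hZ⟩ := hD.exists_perfectSpace_hasSmallInfiniteSubspaces
  obtain ⟨K, f, g, _, hf, hg, hf_surj, hg_surj, hfg⟩ := exists_optimal_correspondence x.Rep y.Rep
  rw [← dist_ghDist] at hfg
  have : Nonempty K := hf_surj.nonempty
  let b : K × Z := Classical.arbitrary _
  choose F hF using fun p => exists_isMetricQuotient
    ((continuous_bunchMetric (b := b) (A := A) (r := nndist x y) hf hg).comp (.prodMk_right p))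
  have bunch := isBranchingBunch_of_isMetricQuotient hf hg hf_surj hg_surj hfg hxy hA h0 h1 hF
  refine ⟨F, bunch, fun ⟨s, q⟩ => ?_⟩
  rcases eq_or_ne s 0 with rfl | hs0
  · exact (bunch.endpoints q).1 ▸ hx
  rcases eq_or_ne s 1 with rfl | hs1
  · exact (bunch.endpoints q).2 ▸ hy
  refine hD.mem_infiniteSet hZ (hF (s, q)) (j := fun z => Sum.inl (b.1, z))
    (truncation_pos (r := nndist x y) hxy hs0 hs1) fun z z' hzz' => ?_
  exact (bunchMetric_inl_inl _ _ _).trans (min_eq_left hzz')
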